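/- An ordinal is called initial if it is not equinumerous with any smaller ordinal, and an initial ordinal $\tau$ is called regular if $\mathrm{cf}(\tau)=\tau$. For an ordinal $\alpha$, give $[0,\alpha]=\{\xi:0\le\xi\le\alpha\}$ the order topology, and let $C_p([0,\alpha])$ be the set of all continuous functions $[0,\alpha]\to\mathbb{R}$ with the topology of pointwise convergence. Theorem. Let $\tau$ be a regular initial ordinal, and let $\sigma,\lambda$ be initial ordinals with $\omega\le\sigma<\lambda\le\tau$. Then the spaces $C_p([0,\tau\cdot\sigma])$ and $C_p([0,\tau\cdot\lambda])$ are not homeomorphic. (Here $\tau\cdot\sigma$ is the ordinal product, that is, the order type of $\sigma$ consecutive copies of $\tau$.) -/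

import Mathlib

/-- `C_p(X)`: the continuous real-valued functions on `X`, with the topology of pointwise
convergence, i.e. the topology induced by the product topology of `X → ℝ`. -/
abbrev Cp (X : Type*) [TopologicalSpace X] : Type _ :=
  {f : X → ℝ // Continuous f}

/-!
The invariant that separates the two spaces is the number of points of large cofinality: for an
uncountable cardinal `κ`, the number of points `x` of `X` with `κ ≤ cof (Iio x)` can be recovered,
up to `ℵ₀`, from the topological space `Cp X` (`mk_cofGE_le`). For `κ = |τ|` there are at most
`|σ|` such points in `[0, τ * σ]`, because they are multiples of `τ`, and at least `|μ|` of them in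
`[0, τ * μ]`, namely the points `τ * (ξ + 1)`.

Let `Φ : Cp Y ≃ₜ Cp X`, and call `f : Y → ℝ` approximable if it agrees with a continuous function
on every set of fewer than `κ` points. A continuous function `Cp Y → ℝ` is locally constant "at" an
approximable `f`: it takes a single value on all `g` that agree with `f` on a suitable countable set
(`exists_countable_forall_eqOn`). Hence `Φ` extends to approximable functions, and the extension
sends discontinuous functions to discontinuous ones (`continuous_of_extension_continuous`).
If `y` has cofinality at least `κ`, the indicator of `{y}` is approximable and discontinuous;
let `u y` be its image. As `u y` is approximable, it can only be discontinuous at a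
point `x` of cofinality at least `κ` (`Approximable.continuousAt`). If there were
uncountably many such `y`, and more of them than such `x`, infinitely many `y` would share the same
`x` and the same lower bound `ε` for the oscillation of `u y` at `x`. As `x` has uncountable cofinality, one point `w < x`, as close to `x`
as desired, then satisfies `ε ≤ |u y w - u y x|` for infinitely many `y` at once
(`exists_forall_le_abs_sub`). But the indicators of distinct points `y` tend to `0` pointwise, so
`u y w - u y x` tends to `Φ 0 w - Φ 0 x`, which is small: a contradiction.
-/

open Set Filter Topology Cardinal

universe u

theorem mk_lt_of_countable {Z : Type u} {κ : Cardinal.{u}} (hκ : ℵ₀ < κ) {A : Set Z}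
    (hA : A.Countable) : #A < κ :=
  (le_aleph0_iff_set_countable.2 hA).trans_lt hκ

/-! ### Spaces of continuous functions in the topology of pointwise convergence -/

section Cp

variable {X Y : Type u} [TopologicalSpace X] [TopologicalSpace Y]

/-- In a normal `T₁` space, values prescribed on two finite sets are attained by one continuous
function as soon as the prescriptions agree on the intersection. -/
theorem exists_cp_eqOn_eqOn [T1Space X] [NormalSpace X] (g h : X → ℝ) (D E : Finset X)
    (hgh : ∀ x ∈ D, x ∈ E → g x = h x) :
    ∃ k : Cp X, EqOn k.1 g D ∧ EqOn k.1 h E := by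
  classical
  have hfin : ((D ∪ E : Finset X) : Set X).Finite := Finset.finite_toSet _
  have : Finite ((D ∪ E : Finset X) : Set X) := hfin
  let φ : X → ℝ := fun x => if x ∈ D then g x else h x
  obtain ⟨k, hk⟩ := ContinuousMap.exists_restrict_eq hfin.isClosed
    (⟨fun x : ((D ∪ E : Finset X) : Set X) => φ x.1, continuous_of_discreteTopology⟩ : C(_, ℝ))
  have hk' : ∀ x ∈ D ∪ E, k x = φ x := fun x hx =>
    congrArg (fun F : C(((D ∪ E : Finset X) : Set X), ℝ) => F ⟨x, hx⟩) hk
  refine ⟨⟨k, k.continuous⟩, fun x hx => ?_, fun x hx => ?_⟩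
  · have hx : x ∈ D := hx
    simp [hk' x (Finset.mem_union_left _ hx), φ, hx]
  · have hx : x ∈ E := hx
    by_cases hD : x ∈ D
    · simp [hk' x (Finset.mem_union_right _ hx), φ, hD, hgh x hD hx]
    · simp [hk' x (Finset.mem_union_right _ hx), φ, hD]

theorem exists_finset_forall_eqOn_mem {U : Set (Cp X)} (hU : IsOpen U) {g : Cp X} (hg : g ∈ U) :
    ∃ D : Finset X, ∀ h : Cp X, EqOn h.1 g.1 D → h ∈ U := by
  obtain ⟨V, hV, rfl⟩ := isOpen_induced_iff.1 hU
  obtain ⟨D, W, hW, hD⟩ := isOpen_pi_iff.1 hV g.1 hg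
  refine ⟨D, fun h hh => hD fun x hx => ?_⟩
  rw [hh hx]
  exact (hW x hx).2

/-- If `f` agrees on every countable set with a continuous function, then a continuous function `k`
on `Cp X` has a well-defined value at `f`: it takes the same value at all continuous functions that
agree with `f` on a suitable countable set. -/
theorem exists_countable_forall_eqOn [T1Space X] [NormalSpace X] {k : Cp X → ℝ}
    (hk : Continuous k) {f : X → ℝ}
    (hf : ∀ A : Set X, A.Countable → ∃ g : Cp X, EqOn g.1 f A) :
    ∃ A : Set X, A.Countable ∧ ∃ c, ∀ g : Cp X, EqOn g.1 f A → k g = c := by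
  classical
  by_contra! hcon
  -- One rational `p` separates two values of `k`, whatever the countable set.
  have hp : ∃ p : ℚ, ∀ A : Set X, A.Countable → ∃ g h : Cp X, EqOn g.1 f A ∧ EqOn h.1 f A ∧
      k g < p ∧ p < k h := by
    by_contra! H
    choose A hA hAk using H
    have hAc : (⋃ p, A p).Countable := countable_iUnion hA
    obtain ⟨g, hg⟩ := hf _ hAc
    obtain ⟨h, hh, hne⟩ := hcon _ hAc (k g)
    have hsub : ∀ p, A p ⊆ ⋃ p, A p := subset_iUnion A
    rcases lt_or_gt_of_ne hne with hlt | hlt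
    · obtain ⟨p, hp1, hp2⟩ := exists_rat_btwn hlt
      exact (hAk p h g (hh.mono (hsub p)) (hg.mono (hsub p)) hp1).not_gt hp2
    · obtain ⟨p, hp1, hp2⟩ := exists_rat_btwn hlt
      exact (hAk p g h (hg.mono (hsub p)) (hh.mono (hsub p)) hp1).not_gt hp2
  obtain ⟨p, hp⟩ := hp
  have hlow : ∀ S : Finset X, ∃ (g : Cp X) (D : Finset X), EqOn g.1 f S ∧
      ∀ h : Cp X, EqOn h.1 g.1 D → k h < p := by
    intro S
    obtain ⟨g, -, hg, -, hgp, -⟩ := hp S S.countable_toSet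
    obtain ⟨D, hD⟩ := exists_finset_forall_eqOn_mem (hk.isOpen_preimage _ isOpen_Iio) hgp
    exact ⟨g, D, hg, hD⟩
  choose G D hG hD using hlow
  obtain ⟨S, hS⟩ : ∃ S : ℕ → Finset X, ∀ n, S (n + 1) = S n ∪ D (S n) :=
    ⟨fun n => Nat.rec ∅ (fun _ T => T ∪ D T) n, fun _ => rfl⟩
  have hmono : Monotone S := monotone_nat_of_le_succ fun n => by
    rw [hS]; exact Finset.subset_union_left
  obtain ⟨-, h, -, hh, -, hhp⟩ := hp (⋃ n, (S n : Set X)) <|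
    countable_iUnion fun n => (S n).countable_toSet
  obtain ⟨E, hE⟩ := exists_finset_forall_eqOn_mem (hk.isOpen_preimage _ isOpen_Ioi) hhp
  -- As `E` is finite, it meets no set `D (S n) \ S n` for large `n`.
  have hn : ∃ n, ∀ x ∈ E, (∃ m, x ∈ S m) → x ∈ S n := by
    have : ∀ x, ∃ n, (∃ m, x ∈ S m) → x ∈ S n := fun x => by
      by_cases hx : ∃ m, x ∈ S m
      · obtain ⟨m, hm⟩ := hx
        exact ⟨m, fun _ => hm⟩
      · exact ⟨0, fun h => absurd h hx⟩
    choose N hN using this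
    exact ⟨E.sup N, fun x hx hm => hmono (Finset.le_sup hx) (hN x hm)⟩
  obtain ⟨n, hn⟩ := hn
  obtain ⟨l, hl1, hl2⟩ := exists_cp_eqOn_eqOn (G (S n)).1 h.1 (D (S n)) E (by
    intro x hx hxE
    have hx' : x ∈ S (n + 1) := by rw [hS]; exact Finset.mem_union_right _ hx
    rw [hG (S n) (hn x hxE ⟨_, hx'⟩), hh (mem_iUnion.2 ⟨n + 1, hx'⟩)])
  have h1 : k l < p := hD _ l hl1
  have h2 : p < k l := hE l hl2
  exact h1.not_gt h2

/-- A function is `κ`-approximable if it agrees with a continuous function on every set of fewer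
than `κ` points. -/
def Approximable (κ : Cardinal.{u}) (f : X → ℝ) : Prop :=
  ∀ A : Set X, #A < κ → ∃ g : Cp X, EqOn g.1 f A

variable {κ : Cardinal.{u}}

/-- `u` is the image of `f`, which need not be continuous, under the extension of
`Φ : Cp Y → Cp X`: for each `x`, the function `Φ g` takes the value `u x` at `x` as soon as `g`
agrees with `f` on the countable set `A x`. -/
def IsExtensionValue (Φ : Cp Y → Cp X) (f : Y → ℝ) (u : X → ℝ) (A : X → Set Y) : Prop :=
  (∀ x, (A x).Countable) ∧ ∀ x (g : Cp Y), EqOn g.1 f (A x) → (Φ g).1 x = u x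

theorem Approximable.exists_isExtensionValue [T1Space Y] [NormalSpace Y] (hκ : ℵ₀ < κ)
    {f : Y → ℝ} (hf : Approximable κ f) {Φ : Cp Y → Cp X} (hΦ : Continuous Φ) :
    ∃ u A, IsExtensionValue Φ f u A := by
  have : ∀ x : X, ∃ A : Set Y, A.Countable ∧ ∃ c, ∀ g : Cp Y, EqOn g.1 f A → (Φ g).1 x = c :=
    fun x => exists_countable_forall_eqOn
      (k := fun g => (Φ g).1 x) ((continuous_apply x).comp (continuous_subtype_val.comp hΦ))
      fun A hA => hf A (mk_lt_of_countable hκ hA)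
  choose A hA u hu using this
  exact ⟨u, A, hA, hu⟩

theorem IsExtensionValue.mk_biUnion_lt {Φ : Cp Y → Cp X} {f : Y → ℝ} {u : X → ℝ} {A : X → Set Y}
    (h : IsExtensionValue Φ f u A) (hκ : ℵ₀ < κ) {B : Set X} (hB : #B < κ) :
    #(⋃ x ∈ B, A x : Set Y) < κ := by
  refine (mk_biUnion_le A B).trans_lt (mul_lt_of_lt hκ.le hB ?_)
  exact (ciSup_le' fun x : B => le_aleph0_iff_set_countable.2 (h.1 x.1)).trans_lt hκ

theorem IsExtensionValue.eqOn {Φ : Cp Y → Cp X} {f : Y → ℝ} {u : X → ℝ} {A : X → Set Y}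
    (h : IsExtensionValue Φ f u A) {B : Set X} {g : Cp Y} (hg : EqOn g.1 f (⋃ x ∈ B, A x)) :
    EqOn (Φ g).1 u B :=
  fun x hx => h.2 x g (hg.mono (subset_biUnion_of_mem hx))

theorem IsExtensionValue.approximable {Φ : Cp Y → Cp X} {f : Y → ℝ} {u : X → ℝ} {A : X → Set Y}
    (h : IsExtensionValue Φ f u A) (hκ : ℵ₀ < κ) (hf : Approximable κ f) : Approximable κ u := by
  intro B hB
  obtain ⟨g, hg⟩ := hf _ (h.mk_biUnion_lt hκ hB)
  exact ⟨Φ g, h.eqOn hg⟩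

/-- The extension of a homeomorphism `Φ` takes continuous values only at continuous functions, since
the inverse of `Φ` recovers `f` from a continuous value. -/
theorem continuous_of_extension_continuous [T1Space X] [NormalSpace X] (hκ : ℵ₀ < κ)
    (Φ : Cp Y ≃ₜ Cp X) {f : Y → ℝ} (hf : Approximable κ f) {u : X → ℝ} {A : X → Set Y}
    (h : IsExtensionValue Φ f u A) (hu : Continuous u) : Continuous f := by
  suffices hfv : f = (Φ.symm ⟨u, hu⟩).1 by
    rw [hfv]; exact (Φ.symm ⟨u, hu⟩).2
  funext z
  obtain ⟨B, hB, c, hc⟩ := exists_countable_forall_eqOn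
    (k := fun g => (Φ.symm g).1 z) (f := u)
    ((continuous_apply z).comp (continuous_subtype_val.comp Φ.symm.continuous))
    fun _ _ => ⟨⟨u, hu⟩, fun _ _ => rfl⟩
  obtain ⟨g, hg⟩ := hf ((⋃ x ∈ B, A x) ∪ {z}) <|
    (mk_union_le _ _).trans_lt <| add_lt_of_lt hκ.le
      (h.mk_biUnion_lt hκ (mk_lt_of_countable hκ hB))
      (mk_lt_of_countable hκ (countable_singleton z))
  have h1 := hc (Φ g) (h.eqOn (hg.mono subset_union_left))
  have h2 := hc ⟨u, hu⟩ fun _ _ => rfl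
  simp only [Homeomorph.symm_apply_apply] at h1 h2
  rw [h2, ← h1, hg (Or.inr rfl)]

end Cp

/-! ### Well-ordered spaces and the cofinality of their points -/

section WellOrder

variable {X : Type u} [LinearOrder X] {κ : Cardinal.{u}}

variable (X κ) in
/-- The set of points of cofinality at least `κ`. -/
def cofGE : Set X := {x | κ ≤ Order.cof (Iio x)}

theorem exists_lt_forall_lt_of_mem_cofGE {x : X} (hx : x ∈ cofGE X κ) {A : Set X} (hA : #A < κ) :
    ∃ z < x, ∀ a ∈ A, a < x → a < z := by
  by_contra! H
  have hcof : IsCofinal ((↑) ⁻¹' A : Set (Iio x)) := fun z => by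
    obtain ⟨a, ha, hax, hza⟩ := H z.1 z.2
    exact ⟨⟨a, hax⟩, ha, hza⟩
  exact ((Order.cof_le hcof).trans (mk_preimage_of_injective _ A Subtype.val_injective)).not_gt
    (hA.trans_le hx)

theorem exists_lt_of_mem_cofGE (hκ : ℵ₀ < κ) {x : X} (hx : x ∈ cofGE X κ) : ∃ z, z < x := by
  obtain ⟨z, hz, -⟩ := exists_lt_forall_lt_of_mem_cofGE hx
    (mk_lt_of_countable hκ countable_empty)
  exact ⟨z, hz⟩

/-- For distinct points `y n` of uncountable cofinality there are pairwise disjoint left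
neighbourhoods `Ioc (z n) (y n)`. -/
theorem exists_pairwise_disjoint_Ioc (hκ : ℵ₀ < κ) {y : ℕ → X} (hy : ∀ n, y n ∈ cofGE X κ)
    (hinj : Function.Injective y) :
    ∃ z : ℕ → X, (∀ n, z n < y n) ∧
      ∀ m n v, v ∈ Ioc (z m) (y m) → v ∈ Ioc (z n) (y n) → m = n := by
  have := fun n => exists_lt_forall_lt_of_mem_cofGE (hy n)
    (mk_lt_of_countable hκ (countable_range y))
  choose z hz hyz using this
  refine ⟨z, hz, fun m n v hm hn => hinj ?_⟩
  by_contra hne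
  rcases lt_or_gt_of_ne hne with h | h
  · exact (hyz n _ ⟨m, rfl⟩ h).not_ge (hn.1.le.trans hm.2)
  · exact (hyz m _ ⟨n, rfl⟩ h).not_ge (hm.1.le.trans hn.2)

theorem exists_forall_abs_sub_lt [TopologicalSpace X] [OrderTopology X] {f : X → ℝ} {x : X}
    (hf : ContinuousAt f x) (hx : ∃ z, z < x) {ε : ℝ} (hε : 0 < ε) :
    ∃ z < x, ∀ w ∈ Ioo z x, |f w - f x| < ε := by
  obtain ⟨z, hz, h⟩ := exists_Ioc_subset_of_mem_nhds (Metric.continuousAt_iff'.1 hf ε hε) hx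
  exact ⟨z, hz, fun w hw => h ⟨hw.1, hw.2.le⟩⟩

theorem not_continuous_indicator_singleton [TopologicalSpace X] [OrderTopology X] {y : X}
    (hy : y ∈ cofGE X κ) (hκ : ℵ₀ < κ) :
    ¬ Continuous (indicator {y} (1 : X → ℝ)) := by
  intro h
  obtain ⟨z, hz, hlt⟩ := exists_forall_abs_sub_lt h.continuousAt (exists_lt_of_mem_cofGE hκ hy)
    one_pos
  obtain ⟨v, hv, hzv⟩ := exists_lt_forall_lt_of_mem_cofGE hy
    (mk_lt_of_countable hκ (countable_singleton z))
  have := hlt v ⟨hzv z rfl hz, hv⟩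
  simp [hv.ne] at this

variable [WellFoundedLT X] [TopologicalSpace X] [OrderTopology X]

theorem isOpen_Iic_of_wellFoundedLT (x : X) : IsOpen (Iic x) := by
  by_cases hx : (Ioi x).Nonempty
  · have hlt := WellFounded.min_mem (wellFounded_lt (α := X)) (Ioi x) hx
    have : Iic x = Iio (WellFounded.min (wellFounded_lt (α := X)) (Ioi x) hx) := by
      ext y
      refine ⟨fun hy => lt_of_le_of_lt hy hlt, fun hy => ?_⟩
      by_contra hxy
      exact WellFounded.not_lt_min (wellFounded_lt (α := X)) (Ioi x) (not_le.1 hxy) hy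
    rw [this]
    exact isOpen_Iio
  · have : Iic x = Set.univ := by
      ext y
      refine iff_of_true ?_ trivial
      by_contra hxy
      exact hx ⟨y, not_le.1 hxy⟩
    rw [this]
    exact isOpen_univ

theorem isClopen_Ioc_of_wellFoundedLT (x y : X) : IsClopen (Ioc x y) := by
  refine ⟨?_, isOpen_Ioi.inter (isOpen_Iic_of_wellFoundedLT y)⟩
  have : Ioc x y = (Iic x)ᶜ ∩ Iic y := by
    ext; simp
  rw [this]
  exact (isOpen_Iic_of_wellFoundedLT x).isClosed_compl.inter isClosed_Iic

theorem exists_forall_exists_le_abs_sub {f : X → ℝ} {x : X} (hf : ¬ ContinuousAt f x) :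
    (∃ z, z < x) ∧ ∃ ε > 0, ∀ z < x, ∃ w ∈ Ioo z x, ε ≤ |f w - f x| := by
  constructor
  · by_contra! H
    have hx : Iic x = {x} := by
      ext w; exact ⟨fun hw => le_antisymm hw (H w), fun hw => le_of_eq hw⟩
    refine hf (continuousAt_of_tendsto_nhds (y := f x) ?_)
    refine tendsto_nhds_of_eventually_eq ?_
    filter_upwards [(isOpen_Iic_of_wellFoundedLT x).mem_nhds self_mem_Iic] with w hw
    rw [hx] at hw
    rw [hw]
  · by_contra! H
    refine hf (Metric.continuousAt_iff'.2 fun ε hε => ?_)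
    obtain ⟨z, hz, h⟩ := H ε hε
    filter_upwards [(isClopen_Ioc_of_wellFoundedLT z x).isOpen.mem_nhds ⟨hz, le_rfl⟩] with w hw
    rcases hw.2.eq_or_lt with rfl | hwx
    · simpa using hε
    · exact h w ⟨hw.1, hwx⟩

theorem Approximable.continuousAt (hκ : ℵ₀ < κ) {u : X → ℝ} (hu : Approximable κ u) {x : X}
    (hx : x ∉ cofGE X κ) : ContinuousAt u x := by
  by_contra hcont
  obtain ⟨hne, ε, hε, H⟩ := exists_forall_exists_le_abs_sub hcont
  choose! w hw hwε using H
  obtain ⟨s, hs, hsc⟩ := Order.exists_cof_eq (Iio x)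
  obtain ⟨g, hg⟩ := hu (insert x (range fun t : s => w t.1.1)) <|
    mk_insert_le.trans_lt <| add_lt_of_lt hκ.le
      (mk_range_le.trans_lt (by rw [hsc]; exact not_le.1 hx)) (one_lt_aleph0.trans hκ)
  obtain ⟨z, hz, h⟩ := exists_forall_abs_sub_lt g.2.continuousAt hne hε
  obtain ⟨t, ht, hzt⟩ := hs ⟨z, hz⟩
  have hwt := h (w t.1) ⟨lt_of_le_of_lt hzt (hw _ t.2).1, (hw _ t.2).2⟩
  rw [hg (mem_insert _ _), hg (mem_insert_of_mem _ ⟨⟨t, ht⟩, rfl⟩)] at hwt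
  exact hwt.not_ge (hwε _ t.2)

/-- If countably many functions oscillate by at least `ε` at a point `x` of uncountable cofinality,
and are continuous at the points of countable cofinality, then they do so along common points. Such
a point is the supremum of an increasing sequence that visits the oscillation set of each function
infinitely often. -/
theorem exists_forall_le_abs_sub (hκ : ℵ₀ < κ) {x : X} (hx : x ∈ cofGE X κ) {u : ℕ → X → ℝ} {ε : ℝ}
    (hu : ∀ n, ∀ w ∉ cofGE X κ, ContinuousAt (u n) w)
    (hosc : ∀ n, ∀ z < x, ∃ w ∈ Ioo z x, ε ≤ |u n w - u n x|) {z : X} (hz : z < x) :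
    ∃ w ∈ Ioo z x, ∀ n, ε ≤ |u n w - u n x| := by
  choose W hW hWε using hosc
  let a : ℕ → Iio x := fun k =>
    Nat.rec ⟨z, hz⟩ (fun k b => ⟨W k.unpair.1 b.1 b.2, (hW k.unpair.1 b.1 b.2).2⟩) k
  have ha : ∀ k, (a (k + 1)).1 = W k.unpair.1 (a k).1 (a k).2 := fun k => rfl
  have hlt : ∀ k, (a k).1 < (a (k + 1)).1 := fun k => (hW k.unpair.1 (a k).1 (a k).2).1
  have hmono : StrictMono fun k => (a k).1 := strictMono_nat_of_lt_succ hlt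
  obtain ⟨b, hbx, hb⟩ := exists_lt_forall_lt_of_mem_cofGE hx
    (mk_lt_of_countable hκ (countable_range fun k => (a k).1))
  have hne : {c | ∀ k, (a k).1 < c}.Nonempty := ⟨b, fun k => hb _ ⟨k, rfl⟩ (a k).2⟩
  obtain ⟨w, hw, hmin⟩ : ∃ w, (∀ k, (a k).1 < w) ∧ ∀ c, (∀ k, (a k).1 < c) → w ≤ c :=
    ⟨_, WellFounded.min_mem wellFounded_lt _ hne,
      fun c hc => not_lt.1 (WellFounded.not_lt_min wellFounded_lt {c | ∀ k, (a k).1 < c} hc)⟩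
  have hwx : w < x := (hmin b fun k => hb _ ⟨k, rfl⟩ (a k).2).trans_lt hbx
  have hwcof : w ∉ cofGE X κ := fun h => by
    obtain ⟨c, hcw, hc⟩ := exists_lt_forall_lt_of_mem_cofGE h
      (mk_lt_of_countable hκ (countable_range fun k => (a k).1))
    exact (hmin c fun k => hc _ ⟨k, rfl⟩ (hw k)).not_gt hcw
  have hlub : IsLUB (range fun k => (a k).1) w :=
    ⟨by rintro _ ⟨k, rfl⟩; exact (hw k).le,
      fun c hc => hmin c fun k => (hlt k).trans_le (hc ⟨k + 1, rfl⟩)⟩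
  have htend : Tendsto (fun k => (a k).1) atTop (𝓝 w) := tendsto_atTop_isLUB hmono.monotone hlub
  refine ⟨w, ⟨hw 0, hwx⟩, fun n => ?_⟩
  have hsub : Tendsto (fun j => Nat.pair n j + 1) atTop atTop :=
    tendsto_atTop_mono (fun j => (Nat.right_le_pair n j).trans (Nat.le_succ _)) tendsto_id
  have hlim : Tendsto (fun j => |u n (a (Nat.pair n j + 1)).1 - u n x|) atTop
      (𝓝 |u n w - u n x|) :=
    (((hu n w hwcof).tendsto.comp (htend.comp hsub)).sub_const _).abs
  refine ge_of_tendsto' hlim fun j => ?_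
  have h := hWε (Nat.pair n j).unpair.1 (a (Nat.pair n j)).1 (a (Nat.pair n j)).2
  rw [← ha, Nat.unpair_pair] at h
  exact h

/-- A continuous function that imitates the indicator of `{y}` on a small set, and vanishes off a
prescribed left neighbourhood of `y`. -/
theorem exists_cp_eqOn_indicator {y : X} (hy : y ∈ cofGE X κ) (hκ : ℵ₀ < κ) {z : X} (hz : z < y)
    {A : Set X} (hA : #A < κ) :
    ∃ g : Cp X, EqOn g.1 (indicator {y} 1) A ∧ ∀ w ∉ Ioc z y, g.1 w = 0 := by
  obtain ⟨v, hv, hAv⟩ := exists_lt_forall_lt_of_mem_cofGE hy (A := insert z A)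
    (mk_insert_le.trans_lt (add_lt_of_lt hκ.le hA (one_lt_aleph0.trans hκ)))
  have hzv : z < v := hAv z (mem_insert _ _) hz
  refine ⟨⟨indicator (Ioc v y) 1,
    continuous_one.indicator fun w hw => by
      simp [(isClopen_Ioc_of_wellFoundedLT v y).frontier_eq] at hw⟩,
    fun w hw => ?_, fun w hw => ?_⟩
  · rcases lt_trichotomy w y with h | h | h
    · have := hAv w (mem_insert_of_mem _ hw) h
      simp [indicator, h.ne, this.not_gt]
    · simp [indicator, h, hv]
    · simp [indicator, h.ne', h]
  · refine indicator_of_notMem (fun h => hw ⟨hzv.trans h.1, h.2⟩) _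

/-! ### The number of points of large cofinality -/

/-- Beyond `ℵ₀`, the number of points of cofinality at least `κ` is an invariant of `Cp X`. -/
theorem mk_cofGE_le {Y : Type u} [LinearOrder Y] [WellFoundedLT Y] [TopologicalSpace Y]
    [OrderTopology Y] (hκ : ℵ₀ < κ) (Φ : Cp Y ≃ₜ Cp X) : #(cofGE Y κ) ≤ max #(cofGE X κ) ℵ₀ := by
  by_contra! hcard
  have happ : ∀ y : cofGE Y κ, Approximable κ (indicator {y.1} (1 : Y → ℝ)) := fun y A hA => by
    obtain ⟨z, hz⟩ := exists_lt_of_mem_cofGE hκ y.2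
    obtain ⟨g, hg, -⟩ := exists_cp_eqOn_indicator y.2 hκ hz hA
    exact ⟨g, hg⟩
  choose u A huA using fun y => (happ y).exists_isExtensionValue hκ Φ.continuous
  have hcont : ∀ y, ∀ w ∉ cofGE X κ, ContinuousAt (u y) w := fun y w hw =>
    ((huA y).approximable hκ (happ y)).continuousAt hκ hw
  have hosc : ∀ y, ∃ p : cofGE X κ × ℕ,
      ∀ z < p.1.1, ∃ w ∈ Ioo z p.1.1, 1 / ((p.2 : ℝ) + 1) ≤ |u y w - u y p.1.1| := by
    intro y
    have hdis : ¬ Continuous (u y) := fun h => not_continuous_indicator_singleton y.2 hκ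
      (continuous_of_extension_continuous hκ Φ (happ y) (huA y) h)
    rw [continuous_iff_continuousAt] at hdis
    push Not at hdis
    obtain ⟨x, hx⟩ := hdis
    obtain ⟨-, ε, hε, H⟩ := exists_forall_exists_le_abs_sub hx
    obtain ⟨m, hm⟩ := exists_nat_one_div_lt hε
    refine ⟨⟨⟨x, not_not.1 fun h => hx (hcont y x h)⟩, m⟩, fun z hz => ?_⟩
    obtain ⟨w, hw, hwε⟩ := H z hz
    exact ⟨w, hw, hm.le.trans hwε⟩
  choose p hp using hosc
  have hprod : #(cofGE X κ × ℕ) ≤ max #(cofGE X κ) ℵ₀ := by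
    rw [mk_prod, lift_uzero, mk_nat, lift_aleph0]
    exact (mul_le_max _ _).trans (by simp)
  obtain ⟨⟨x, m⟩, hfib⟩ := infinite_pigeonhole_card_lt p (hprod.trans_lt hcard)
    ((le_max_right _ _).trans hcard.le)
  have hinf : Infinite (p ⁻¹' {(x, m)}) := by
    have : Nonempty (cofGE X κ) := ⟨x⟩
    rw [infinite_iff]
    exact (aleph0_le_mk (cofGE X κ × ℕ)).trans hfib.le
  let e := Infinite.natEmbedding (p ⁻¹' {(x, m)})
  have hpe : ∀ n, p (e n).1 = (x, m) := fun n => (e n).2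
  set ε : ℝ := 1 / ((m : ℝ) + 1) with hεdef
  have hε : 0 < ε := by positivity
  obtain ⟨z, hz, hzε⟩ := exists_forall_abs_sub_lt
    (Φ ⟨0, continuous_zero⟩).2.continuousAt (exists_lt_of_mem_cofGE hκ x.2) hε
  obtain ⟨w, hw, hwε⟩ := exists_forall_le_abs_sub hκ x.2 (u := fun n => u (e n).1) (ε := ε)
    (fun n => hcont _) (fun n => by
      have := hp (e n).1
      rw [hpe] at this
      exact this) hz
  obtain ⟨l, hl, hdisj⟩ := exists_pairwise_disjoint_Ioc hκ (y := fun n => (e n).1.1)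
    (fun n => (e n).1.2) (Subtype.val_injective.comp (Subtype.val_injective.comp e.injective))
  -- Continuous `g n` that imitate the indicators closely enough for `Φ (g n)` to take the values of
  -- `u (e n)` at `w` and `x`; their supports are disjoint, so they tend to `0` pointwise.
  choose g hg hg0 using fun n => exists_cp_eqOn_indicator (e n).1.2 hκ (hl n)
    (mk_lt_of_countable hκ (((huA (e n).1).1 w).union ((huA (e n).1).1 x.1)))
  have hglim : Tendsto g atTop (𝓝 ⟨0, continuous_zero⟩) := by
    refine tendsto_subtype_rng.2 (tendsto_pi_nhds.2 fun v => tendsto_nhds_of_eventually_eq ?_)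
    by_cases hv : ∃ n, v ∈ Ioc (l n) (e n).1.1
    · obtain ⟨n, hn⟩ := hv
      filter_upwards [eventually_gt_atTop n] with k hk
      exact hg0 k v fun hkv => hk.ne (hdisj n k v hn hkv)
    · push Not at hv
      exact Eventually.of_forall fun n => hg0 n v (hv n)
  have hlim := tendsto_pi_nhds.1
    (tendsto_subtype_rng.1 ((Φ.continuous.tendsto _).comp hglim))
  have habs := ((hlim w).sub (hlim x.1)).abs
  refine (ge_of_tendsto' habs fun n => ?_).not_gt (hzε w hw)
  have h1 := (huA (e n).1).2 w (g n) ((hg n).mono subset_union_left)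
  have h2 := (huA (e n).1).2 x.1 (g n) ((hg n).mono subset_union_right)
  simp only [Function.comp_apply, h1, h2]
  exact hwε n

end WellOrder

/-! ### Segments of ordinals -/

section Ordinal

open Ordinal

theorem mem_cofGE_Icc_iff {α : Ordinal.{u}} {c : Cardinal.{u}} (x : Icc (0 : Ordinal.{u}) α) :
    x ∈ cofGE (Icc (0 : Ordinal.{u}) α) (lift.{u + 1} c) ↔ c ≤ x.1.cof := by
  let i : Iio x ≃o Iio x.1 :=
    { toFun := fun y => ⟨y.1.1, y.2⟩
      invFun := fun y => ⟨⟨y.1, zero_le, (le_of_lt y.2).trans x.2.2⟩, y.2⟩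
      left_inv := fun _ => rfl
      right_inv := fun _ => rfl
      map_rel_iff' := Iff.rfl }
  rw [cofGE, mem_ofPred_eq, i.cof_congr, cof_Iio, ← lift_cof, Cardinal.lift_le]

/-- The points of `[0, τ * σ]` of cofinality at least `|τ|` are multiples of `τ`: a remainder
`ρ ≠ 0` modulo `τ` bounds the cofinality by `|ρ| < |τ|`. -/
theorem mk_cofGE_Icc_mul_le {τ σ : Ordinal.{u}} (hτ : τ.IsInitial) (hτ0 : τ ≠ 0) :
    #(cofGE (Icc (0 : Ordinal.{u}) (τ * σ)) (lift.{u + 1} τ.card)) ≤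
      lift.{u + 1} (σ + 1).card := by
  rw [← Cardinal.mk_Iio_ordinal (σ + 1)]
  have hmul : ∀ x ∈ cofGE (Icc (0 : Ordinal.{u}) (τ * σ)) (lift.{u + 1} τ.card),
      τ * (x.1 / τ) = x.1 := by
    intro x hx
    rw [mem_cofGE_Icc_iff] at hx
    by_contra hne
    have hρ : x.1 % τ ≠ 0 := fun h => hne (by
      conv_rhs => rw [← Ordinal.div_add_mod x.1 τ, h, add_zero])
    rw [← Ordinal.div_add_mod x.1 τ, cof_add _ hρ] at hx
    exact (hx.trans (cof_le_card _)).not_gt (hτ.card_lt_card.2 (Ordinal.mod_lt _ hτ0))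
  refine mk_le_of_injective (f := fun x => ⟨x.1.1 / τ, ?_⟩) fun x y hxy => ?_
  · rw [mem_Iio, Order.lt_add_one_iff, ← mul_le_mul_iff_right₀ (pos_iff_ne_zero.2 hτ0),
      hmul x.1 x.2]
    exact x.1.2.2
  · have h := congrArg Subtype.val hxy
    refine Subtype.ext (Subtype.ext ?_)
    rw [← hmul x.1 x.2, ← hmul y.1 y.2]
    exact congrArg (τ * ·) h

theorem le_mk_cofGE_Icc_mul {τ μ : Ordinal.{u}} (hτcof : τ.cof = τ.card) (hτ0 : τ ≠ 0) :
    lift.{u + 1} μ.card ≤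
      #(cofGE (Icc (0 : Ordinal.{u}) (τ * μ)) (lift.{u + 1} τ.card)) := by
  rw [← Cardinal.mk_Iio_ordinal μ]
  have hcof : ∀ ξ : Ordinal.{u}, τ.card ≤ (τ * (ξ + 1)).cof := fun ξ => by
    rw [mul_add_one, cof_add _ hτ0, hτcof]
  have hle : ∀ ξ : Iio μ, τ * (ξ.1 + 1) ≤ τ * μ := fun ξ =>
    mul_le_mul_right (Order.add_one_le_of_lt (mem_Iio.1 ξ.2)) τ
  refine mk_le_of_injective
    (f := fun ξ => ⟨⟨τ * (ξ.1 + 1), zero_le, hle ξ⟩, (mem_cofGE_Icc_iff _).2 (hcof ξ)⟩)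
    fun ξ η h => ?_
  have h' : τ * (ξ.1 + 1) = τ * (η.1 + 1) := congrArg (fun z => z.1.1) h
  have hinj := (isNormal_mul_right (pos_iff_ne_zero.2 hτ0)).strictMono.injective h'
  exact Subtype.ext (Order.succ_injective hinj)

end Ordinal

theorem theorem1 (τ σ μ : Ordinal) (hτ : τ.IsInitial)
    (hτreg : τ.cof.ord = τ) (hσ : σ.IsInitial) (hμ : μ.IsInitial)
    (hωσ : Ordinal.omega0 ≤ σ) (hσμ : σ < μ) (hμτ : μ ≤ τ) :
    ¬ Nonempty (Cp (Set.Icc (0 : Ordinal) (τ * σ)) ≃ₜ Cp (Set.Icc (0 : Ordinal) (τ * μ))) := by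
  rintro ⟨Φ⟩
  have hτ0 : τ ≠ 0 := (Ordinal.omega0_pos.trans_le (hωσ.trans (hσμ.le.trans hμτ))).ne'
  have hτcof : τ.cof = τ.card := by rw [← Cardinal.card_ord τ.cof, hτreg]
  have hσinf : ℵ₀ ≤ σ.card := Ordinal.aleph0_le_card.2 hωσ
  have hσμ' : σ.card < μ.card := hμ.card_lt_card.2 hσμ
  have hκ : ℵ₀ < Cardinal.lift τ.card :=
    Cardinal.aleph0_lt_lift.2 (hσinf.trans_lt (hσμ'.trans_le (Ordinal.card_le_card hμτ)))
  have hle := (le_mk_cofGE_Icc_mul hτcof hτ0).trans (mk_cofGE_le hκ Φ.symm)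
  have hσs : (σ + 1).card = σ.card := by
    rw [Ordinal.card_add_one, Cardinal.add_one_eq hσinf]
  have hX := mk_cofGE_Icc_mul_le (σ := σ) hτ hτ0
  rw [hσs] at hX
  exact (hle.trans (max_le hX (Cardinal.aleph0_le_lift.2 hσinf))).not_gt
    (Cardinal.lift_lt.2 hσμ')
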